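/- Let $\Gamma$ be a discrete group that is icc, i.e. the conjugacy class of every $g\neq e$ in $\Gamma$ is infinite, and let $\mu$ be a probability measure on $\Gamma$ whose support generates $\Gamma$ as a group. Let $(X,\nu)$ be an ergodic $(\Gamma,\mu)$-space: $(X,\nu)$ is a probability space with a measurable, nonsingular action of $\Gamma$ (that is, $g\nu$ and $\nu$ have the same null sets for every $g\in\Gamma$), $\nu$ is $\mu$-stationary, $\nu=\sum_{g\in\Gamma}\mu(g)\,g\nu$, and every measurable set $E\subseteq X$ with $\nu(gE\,\triangle\,E)=0$ for all $g\in\Gamma$ satisfies $\nu(E)\in\{0,1\}$. Let $\Gamma\ltimes L^\infty(X)$ be the von Neumann crossed product, i.e. the von Neumann algebra on $\ell^2(\Gamma,L^2(X,\nu))$ generated by the operators $(\pi(f)\xi)(h)=\sigma_{h^{-1}}(f)\,\xi(h)$ for $f\in L^\infty(X,\nu)$, where $(\sigma_g f)(x)=f(g^{-1}x)$, and the unitaries $(\lambda_g\xi)(h)=\xi(g^{-1}h)$ for $g\in\Gamma$. Then the conjugation action $g\cdot a=\lambda_g a\lambda_g^*$ of $\Gamma$ on $\Gamma\ltimes L^\infty(X)$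 is ergodic: $$\{a\in\Gamma\ltimes L^\infty(X) : \lambda_g a\lambda_g^*=a \text{ for all } g\in\Gamma\}=\mathbb{C}1.$$ -/

import Mathlib

open MeasureTheory
open scoped ENNReal

noncomputable section

namespace CrossedProductErgodicity

/-- A group is icc if the conjugacy class of every nontrivial element is infinite. -/
def IsICC (Γ : Type*) [Group Γ] : Prop :=
  ∀ g : Γ, g ≠ 1 → {k : Γ | IsConj g k}.Infinite

/-- The action of `Γ` on `(X, ν)` is measurable and nonsingular: every `x ↦ g • x` is measurable
and maps `ν` to a measure absolutely continuous with respect to `ν`. Since this is asked of `g`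
and of `g⁻¹`, the measures `ν` and `g ν` have the same null sets. -/
class NonsingularAction (Γ : Type*) {X : Type*} [Group Γ] [MulAction Γ X] [MeasurableSpace X]
    (ν : Measure X) : Prop where
  quasiMeasurePreserving : ∀ g : Γ, Measure.QuasiMeasurePreserving (fun x : X => g • x) ν ν

/-- `ν` is `μ`-stationary: `ν = ∑ g, μ(g) g_* ν`. -/
def IsStationary {Γ X : Type*} [Group Γ] [MulAction Γ X] [MeasurableSpace X]
    (μ : PMF Γ) (ν : Measure X) : Prop :=
  ν = Measure.sum fun g : Γ => μ g • ν.map (fun x : X => g • x)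

/-- Ergodicity of a nonsingular action: every measurable set that is invariant modulo null sets is
null or conull. -/
def IsErgodicAction (Γ : Type*) {X : Type*} [Group Γ] [MulAction Γ X] [MeasurableSpace X]
    (ν : Measure X) : Prop :=
  ∀ s : Set X, MeasurableSet s → (∀ g : Γ, (fun x : X => g • x) ⁻¹' s =ᵐ[ν] s) →
    ν s = 0 ∨ ν sᶜ = 0

section CrossedProduct

variable (Γ : Type*) {X : Type*} [Group Γ] [MulAction Γ X] [MeasurableSpace X] (ν : Measure X)

variable {Γ ν} in
theorem memLp_top_comp_smul [NonsingularAction Γ ν] (f : Lp ℂ ∞ ν) (g : Γ) :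
    MemLp (fun x : X => f (g • x)) ∞ ν := by
  have hq := NonsingularAction.quasiMeasurePreserving (ν := ν) g
  have hb : ∀ᵐ x ∂ν, ‖f x‖ ≤ ‖f‖ := by
    filter_upwards [ae_le_eLpNormEssSup (f := f) (μ := ν)] with x hx
    rw [Lp.norm_def, eLpNorm_exponent_top, ← toReal_enorm]
    have hfin := Lp.eLpNorm_ne_top f
    rw [eLpNorm_exponent_top] at hfin
    exact ENNReal.toReal_mono hfin hx
  exact memLp_top_of_bound ((Lp.aestronglyMeasurable f).comp_quasiMeasurePreserving hq) ‖f‖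
    (hq.ae hb)

variable {Γ ν} in
/-- The action of `Γ` on `L^∞(X, ν)`: `(σ_g f)(x) = f (g⁻¹ x)`. -/
def translateLinf [NonsingularAction Γ ν] (g : Γ) (f : Lp ℂ ∞ ν) : Lp ℂ ∞ ν :=
  (memLp_top_comp_smul f g⁻¹).toLp (fun x : X => f (g⁻¹ • x))

variable {Γ ν} in
theorem norm_translateLinf_le [NonsingularAction Γ ν] (g : Γ) (f : Lp ℂ ∞ ν) :
    ‖translateLinf g f‖ ≤ ‖f‖ := by
  have hq := NonsingularAction.quasiMeasurePreserving (ν := ν) g⁻¹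
  rw [translateLinf, Lp.norm_toLp, Lp.norm_def]
  refine ENNReal.toReal_mono (Lp.eLpNorm_ne_top f) ?_
  rw [eLpNorm_exponent_top, eLpNorm_exponent_top]
  exact essSup_le_of_ae_le _ (hq.ae (ae_le_eLpNormEssSup (f := f) (μ := ν)))

variable {ν} in
/-- Multiplication by `f ∈ L^∞(X, ν)` as a bounded operator on `L²(X, ν)`. -/
def mulOp (f : Lp ℂ ∞ ν) : Lp ℂ 2 ν →L[ℂ] Lp ℂ 2 ν :=
  (ContinuousLinearMap.mul ℂ ℂ).holderL ν ∞ 2 2 f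

variable {ν} in
theorem norm_mulOp_le (f : Lp ℂ ∞ ν) : ‖mulOp f‖ ≤ ‖f‖ := by
  refine ContinuousLinearMap.opNorm_le_bound _ (norm_nonneg f) fun ξ => ?_
  have h := (ContinuousLinearMap.mul ℂ ℂ).norm_holder_apply_apply_le (r := 2) f ξ
  simpa [mulOp] using h

/-- The Hilbert space `ℓ²(Γ, L²(X, ν))`. -/
abbrev HilbertSp : Type _ := lp (fun _ : Γ => Lp ℂ 2 ν) 2

variable {ν} in
/-- The representation of `L^∞(X, ν)` on `ℓ²(Γ, L²(X, ν))`: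
`(π(f) ξ)(h) = σ_{h⁻¹}(f) ξ(h)`. -/
def piRep [NonsingularAction Γ ν] (f : Lp ℂ ∞ ν) : HilbertSp Γ ν →L[ℂ] HilbertSp Γ ν :=
  lp.mapCLM 2 (fun h : Γ => mulOp (translateLinf h⁻¹ f)) (norm_nonneg f)
    (fun h => (norm_mulOp_le _).trans (norm_translateLinf_le h⁻¹ f))

variable {Γ} in
/-- `(λ_g ξ)(h) = ξ(g⁻¹ h)`, as a linear isometric automorphism of `ℓ²(Γ, L²(X, ν))`. -/
def leftTranslation (g : Γ) : HilbertSp Γ ν ≃ₗᵢ[ℂ] HilbertSp Γ ν :=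
  have key : ∀ (k : Γ) (ξ : HilbertSp Γ ν), Memℓp (fun h : Γ => ξ (k * h)) 2 := fun k ξ =>
    memℓp_gen ((Equiv.mulLeft k).summable_iff.2 ((lp.memℓp ξ).summable (by norm_num)))
  { toFun := fun ξ => ⟨fun h => ξ (g⁻¹ * h), key g⁻¹ ξ⟩
    invFun := fun ξ => ⟨fun h => ξ (g * h), key g ξ⟩
    map_add' := fun _ _ => rfl
    map_smul' := fun _ _ => rfl
    left_inv := fun ξ => by
      apply lp.ext
      funext h
      exact congrArg (fun k => ξ k) (inv_mul_cancel_left g h)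
    right_inv := fun ξ => by
      apply lp.ext
      funext h
      exact congrArg (fun k => ξ k) (mul_inv_cancel_left g h)
    norm_map' := fun ξ => by
      rw [lp.norm_eq_tsum_rpow (by norm_num), lp.norm_eq_tsum_rpow (by norm_num)]
      congr 1
      exact (Equiv.mulLeft g⁻¹).tsum_eq fun h => ‖ξ h‖ ^ (2 : ℝ≥0∞).toReal }

/-- The unitary representation `g ↦ λ_g` of `Γ` on `ℓ²(Γ, L²(X, ν))`. -/
def leftRegular : Γ →* unitary (HilbertSp Γ ν →L[ℂ] HilbertSp Γ ν) where
  toFun g := Unitary.linearIsometryEquiv.symm (leftTranslation ν g)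
  map_one' := by
    rw [← map_one Unitary.linearIsometryEquiv.symm]
    congr 1
    ext1 ξ
    apply lp.ext
    funext h
    exact congrArg (fun k => ξ k) (by simp)
  map_mul' g k := by
    rw [← map_mul Unitary.linearIsometryEquiv.symm]
    congr 1
    ext1 ξ
    apply lp.ext
    funext h
    exact congrArg (fun l => ξ l) (by simp [mul_assoc])

/-- The von Neumann algebra generated by a set `S` of bounded operators: the double commutant
of `S ∪ S*`. -/
def vonNeumannGenerated {H : Type*} [NormedAddCommGroup H] [InnerProductSpace ℂ H]
    [CompleteSpace H] (S : Set (H →L[ℂ] H)) : VonNeumannAlgebra H where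
  toStarSubalgebra := StarSubalgebra.centralizer ℂ (StarSubalgebra.centralizer ℂ S)
  centralizer_centralizer' := by
    have h := StarSubalgebra.coe_centralizer_centralizer (R := ℂ) S
    exact (congrArg (fun T => Set.centralizer (Set.centralizer T)) h).trans
      ((Set.centralizer_centralizer_centralizer _).trans h.symm)

theorem subset_vonNeumannGenerated {H : Type*} [NormedAddCommGroup H] [InnerProductSpace ℂ H]
    [CompleteSpace H] (S : Set (H →L[ℂ] H)) :
    S ⊆ (vonNeumannGenerated S).toStarSubalgebra := by
  intro a ha
  exact StarAlgebra.adjoin_le_centralizer_centralizer ℂ S (StarAlgebra.subset_adjoin ℂ S ha)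

/-- The von Neumann crossed product `Γ ⋉ L^∞(X, ν)`: the von Neumann algebra on
`ℓ²(Γ, L²(X, ν))` generated by all `π(f)`, `f ∈ L^∞(X, ν)`, and all `λ_g`, `g ∈ Γ`. -/
def crossedProduct [NonsingularAction Γ ν] : VonNeumannAlgebra (HilbertSp Γ ν) :=
  vonNeumannGenerated
    (Set.range (fun f : Lp ℂ ∞ ν => piRep Γ f) ∪
      Set.range (fun g : Γ => (leftRegular Γ ν g : HilbertSp Γ ν →L[ℂ] HilbertSp Γ ν)))

theorem leftRegular_mem_crossedProduct [NonsingularAction Γ ν] (g : Γ) :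
    (leftRegular Γ ν g : HilbertSp Γ ν →L[ℂ] HilbertSp Γ ν) ∈
      (crossedProduct Γ ν).toStarSubalgebra :=
  subset_vonNeumannGenerated _ (Or.inr ⟨g, rfl⟩)

/-- The unitaries `λ_g`, as unitary elements of the crossed product. -/
def canonicalUnitary [NonsingularAction Γ ν] :
    Γ →* unitary (crossedProduct Γ ν).toStarSubalgebra where
  toFun g := ⟨⟨leftRegular Γ ν g, leftRegular_mem_crossedProduct Γ ν g⟩, by
    rw [Unitary.mem_iff]
    exact ⟨Subtype.ext (Unitary.coe_star_mul_self (leftRegular Γ ν g)),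
      Subtype.ext (Unitary.coe_mul_star_self (leftRegular Γ ν g))⟩⟩
  map_one' := by
    apply Subtype.ext
    apply Subtype.ext
    simp
  map_mul' g k := by
    apply Subtype.ext
    apply Subtype.ext
    simp

/-- The conjugation action of `Γ` on the crossed product by *-automorphisms,
`g · a = λ_g a λ_g*`. -/
def conjugationAction [NonsingularAction Γ ν] :
    Γ →* ((crossedProduct Γ ν).toStarSubalgebra ≃⋆ₐ[ℂ] (crossedProduct Γ ν).toStarSubalgebra) :=
  (Unitary.conjStarAlgAut ℂ (crossedProduct Γ ν).toStarSubalgebra).comp (canonicalUnitary Γ ν)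

end CrossedProduct

/-- An action of a group on a *-algebra by *-automorphisms is ergodic if its fixed-point
subalgebra is `ℂ 1`. -/
def IsErgodicAutAction {Γ A : Type*} [Group Γ] [Ring A] [StarRing A] [Algebra ℂ A]
    (α : Γ →* (A ≃⋆ₐ[ℂ] A)) : Prop :=
  {a : A | ∀ g : Γ, α g a = a} = Set.range (algebraMap ℂ A)

end CrossedProductErgodicity

end

/-!
Let `a` in the crossed product commute with every `λ_h`, and let `ξ = a (δ_e ⊗ 1)`; its entries
`ξ_g ∈ L²(X, ν)` play the role of Fourier coefficients of `a`. Stationarity gives `μ(h) h_* ν ≤ ν`,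
so for `h` in the support of `μ` the right translation `(R_h η)(k) = η(k h⁻¹) ∘ h` is a bounded
operator. It lies in the commutant of the crossed product and agrees with `λ_h` on `δ_e ⊗ 1`,
whence `ξ_g ∘ h = ξ_{h⁻¹ g h}`. By stationarity again, `g ↦ ‖ξ_g‖²` is a summable `μ`-harmonic
function for the conjugation action; it attains its maximum on each conjugacy class, on a finite
set of points which is invariant under conjugation, so it vanishes on infinite classes. The
remaining coefficient `ξ_e` is an invariant function, hence constant by ergodicity, and `a` is
determined by `a (δ_e ⊗ 1)` because the vectors `f λ_g (δ_e ⊗ 1)` span a dense subspace.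
-/

noncomputable section

namespace CrossedProductErgodicity

section Harmonic

theorem exists_mem_forall_le_of_tsum_ne_top {α : Type*} {φ : α → ℝ≥0∞} (hφ : ∑' y, φ y ≠ ∞)
    {s : Set α} {x : α} (hx : x ∈ s) (h0 : φ x ≠ 0) :
    ∃ m ∈ s, φ x ≤ φ m ∧ ∀ y ∈ s, φ y ≤ φ m := by
  have hfin : {y ∈ s | φ x ≤ φ y}.Finite :=
    (ENNReal.finite_const_le_of_tsum_ne_top hφ h0).subset fun y hy => hy.2
  obtain ⟨m, ⟨hm, hxm⟩, hmax⟩ := Set.exists_max_image _ φ hfin ⟨x, hx, le_rfl⟩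
  exact ⟨m, hm, hxm, fun y hy => (le_total (φ x) (φ y)).elim (fun h => hmax y ⟨hy, h⟩)
    fun h => h.trans hxm⟩

theorem eq_of_tsum_mul_eq_of_le {α : Type*} (μ : PMF α) {u : α → ℝ≥0∞} {M : ℝ≥0∞} (hM : M ≠ ∞)
    (hle : ∀ a, u a ≤ M) (hsum : ∑' a, μ a * u a = M) {a : α} (ha : a ∈ μ.support) : u a = M := by
  by_contra hne
  have hlt : ∑' b, μ b * u b < ∑' b, μ b * M :=
    ENNReal.tsum_lt_tsum (i := a) (hsum ▸ hM) (fun b => mul_le_mul_right (hle b) _)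
      (ENNReal.mul_lt_mul_right ha (μ.apply_ne_top a) (lt_of_le_of_ne (hle a) hne))
  rw [hsum, ENNReal.tsum_mul_right, μ.tsum_coe, one_mul] at hlt
  exact hlt.false

open scoped Pointwise in
theorem eq_zero_of_harmonic_of_orbit_infinite {G α : Type*} [Group G] [MulAction G α] {μ : PMF G}
    (hμ : Subgroup.closure μ.support = ⊤) {φ : α → ℝ≥0∞} (hφ : ∑' x, φ x ≠ ∞)
    (hharm : ∀ x, φ x = ∑' h, μ h * φ (h⁻¹ • x)) {x : α} (hx : (MulAction.orbit G x).Infinite) :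
    φ x = 0 := by
  by_contra h0
  obtain ⟨m, hm, hxm, hmax⟩ :=
    exists_mem_forall_le_of_tsum_ne_top hφ (MulAction.mem_orbit_self (M := G) x) h0
  let S : Set α := {y ∈ MulAction.orbit G x | φ y = φ m}
  have hSfin : S.Finite :=
    (ENNReal.finite_const_le_of_tsum_ne_top hφ h0).subset fun y hy => hxm.trans hy.2.ge
  have hsupp : μ.support ⊆ MulAction.stabilizer G S := by
    refine fun h hh => inv_mem_iff.1 ((MulAction.mem_stabilizer_set' hSfin).2 ?_)
    rintro y ⟨hy, hym⟩
    refine ⟨MulAction.mem_orbit_of_mem_orbit _ hy, ?_⟩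
    exact eq_of_tsum_mul_eq_of_le μ (u := fun k => φ (k⁻¹ • y))
      (ENNReal.ne_top_of_tsum_ne_top hφ m)
      (fun k => hmax _ (MulAction.mem_orbit_of_mem_orbit _ hy)) ((hharm y).symm.trans hym) hh
  have hstab : MulAction.stabilizer G S = ⊤ := by
    rwa [← top_le_iff, ← hμ, Subgroup.closure_le]
  have horbit : MulAction.orbit G m ⊆ S := by
    rintro _ ⟨g, rfl⟩
    have hg : g ∈ MulAction.stabilizer G S := hstab ▸ Subgroup.mem_top g
    exact (MulAction.mem_stabilizer_set' hSfin).1 hg ⟨hm, rfl⟩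
  rw [MulAction.orbit_eq_iff.2 hm] at horbit
  exact hx (hSfin.subset horbit)

theorem IsICC.eq_zero_of_conj_harmonic {Γ : Type*} [Group Γ] (hΓ : IsICC Γ) {μ : PMF Γ}
    (hμ : Subgroup.closure μ.support = ⊤) {φ : Γ → ℝ≥0∞} (hφ : ∑' g, φ g ≠ ∞)
    (hharm : ∀ g, φ g = ∑' h, μ h * φ (h⁻¹ * g * h)) {g : Γ} (hg : g ≠ 1) : φ g = 0 := by
  have hμ' : Subgroup.closure (PMF.support (α := ConjAct Γ) μ) = ⊤ := hμ
  refine eq_zero_of_harmonic_of_orbit_infinite hμ' hφ (fun x => ?_) ?_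
  · rw [hharm x]
    exact tsum_congr fun h => by rw [← ConjAct.toConjAct_inv_smul]; rfl
  · refine (hΓ g hg).mono fun k hk => ?_
    rwa [ConjAct.mem_orbit_conjAct, isConj_comm]

end Harmonic

section CompositionOperator

variable {X Y E 𝕜 : Type*} [MeasurableSpace X] [MeasurableSpace Y] [NormedAddCommGroup E]
  {μ : Measure X} {ν : Measure Y} {p : ℝ≥0∞} {T : X → Y} {c : ℝ≥0∞}

theorem memLp_comp_of_map_le_smul (hT : Measurable T) (hc : c ≠ ∞) (hle : μ.map T ≤ c • ν)
    {f : Y → E} (hf : MemLp f p ν) : MemLp (f ∘ T) p μ :=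
  (hf.of_measure_le_smul hc hle).comp_of_map hT.aemeasurable

theorem eLpNorm_comp_le_of_map_le_smul (hT : Measurable T) (hle : μ.map T ≤ c • ν)
    {f : Y → E} (hf : AEStronglyMeasurable f ν) :
    eLpNorm (f ∘ T) p μ ≤ c ^ (1 / p).toReal * eLpNorm f p ν := by
  have hac := Measure.absolutelyContinuous_of_le_smul hle
  rw [← eLpNorm_map_measure (hf.mono_ac hac) hT.aemeasurable]
  exact eLpNorm_le_of_measure_le_smul hle

variable (E 𝕜 p) [NormedField 𝕜] [NormedSpace 𝕜 E] [Fact (1 ≤ p)]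

/-- The composition operator `f ↦ f ∘ T` from `L^p(ν)` to `L^p(μ)`. It is bounded as soon as
`T_* μ` is dominated by a finite multiple of `ν`. -/
def compOp (hT : Measurable T) (hc : c ≠ ∞) (hle : μ.map T ≤ c • ν) :
    Lp E p ν →L[𝕜] Lp E p μ :=
  have hq : Measure.QuasiMeasurePreserving T μ ν :=
    ⟨hT, Measure.absolutelyContinuous_of_le_smul hle⟩
  LinearMap.mkContinuous
    { toFun := fun f => (memLp_comp_of_map_le_smul hT hc hle (Lp.memLp f)).toLp (f ∘ T)
      map_add' := fun f g => by
        rw [← MemLp.toLp_add, MemLp.toLp_eq_toLp_iff]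
        exact hq.ae (Lp.coeFn_add f g)
      map_smul' := fun r f => by
        rw [RingHom.id_apply, ← MemLp.toLp_const_smul, MemLp.toLp_eq_toLp_iff]
        exact hq.ae (Lp.coeFn_smul r f) }
    (c ^ (1 / p).toReal).toReal
    fun f => by
      rw [LinearMap.coe_mk, AddHom.coe_mk, Lp.norm_toLp, Lp.norm_def, ← ENNReal.toReal_mul]
      refine ENNReal.toReal_mono (ENNReal.mul_ne_top ?_ (Lp.eLpNorm_ne_top f))
        (eLpNorm_comp_le_of_map_le_smul hT hle (Lp.aestronglyMeasurable f))
      exact ENNReal.rpow_ne_top_of_nonneg ENNReal.toReal_nonneg hc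

variable {E p}

theorem coeFn_compOp (hT : Measurable T) (hc : c ≠ ∞) (hle : μ.map T ≤ c • ν) (f : Lp E p ν) :
    compOp E 𝕜 p hT hc hle f =ᵐ[μ] f ∘ T :=
  MemLp.coeFn_toLp (memLp_comp_of_map_le_smul hT hc hle (Lp.memLp f))

theorem compOp_const [IsFiniteMeasure μ] [IsFiniteMeasure ν] (hT : Measurable T) (hc : c ≠ ∞)
    (hle : μ.map T ≤ c • ν) (e : E) :
    compOp E 𝕜 p hT hc hle (Lp.const p ν e) = Lp.const p μ e := by
  have hq : Measure.QuasiMeasurePreserving T μ ν :=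
    ⟨hT, Measure.absolutelyContinuous_of_le_smul hle⟩
  apply Lp.ext
  filter_upwards [coeFn_compOp 𝕜 hT hc hle (Lp.const p ν e), Lp.coeFn_const (p := p) (μ := μ) e,
    hq.ae (Lp.coeFn_const (p := p) (μ := ν) e)] with x hcomp hμ hν
  rw [hcomp, hμ, Function.comp_apply, hν]
  rfl

end CompositionOperator

section Reindex

variable {ι ι' E : Type*} (𝕜 : Type*) [NormedAddCommGroup E] {p : ℝ≥0∞}

theorem memℓp_comp_equiv (e : ι ≃ ι') {f : ι' → E} (hf : Memℓp f p) : Memℓp (f ∘ e) p := by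
  rcases p.trichotomy with rfl | rfl | hp
  · exact memℓp_zero (hf.finite_dsupport.preimage e.injective.injOn)
  · exact memℓp_infty (hf.bddAbove.mono (Set.range_comp_subset_range e fun i => ‖f i‖))
  · exact memℓp_gen (e.summable_iff.2 (hf.summable hp))

variable [NormedField 𝕜] [NormedSpace 𝕜 E] [Fact (1 ≤ p)]

/-- Reindexing of `ℓ^p(ι', E)` along a bijection `e : ι ≃ ι'`, as a linear isometry `ξ ↦ ξ ∘ e`. -/
def lpReindex (e : ι ≃ ι') : lp (fun _ : ι' => E) p →ₗᵢ[𝕜] lp (fun _ : ι => E) p where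
  toFun ξ := ⟨ξ ∘ e, memℓp_comp_equiv e (lp.memℓp ξ)⟩
  map_add' _ _ := rfl
  map_smul' _ _ := rfl
  norm_map' ξ := by
    rcases p.dichotomy with rfl | hp
    · rw [lp.norm_eq_ciSup, lp.norm_eq_ciSup]
      exact e.iSup_comp (g := fun i => ‖ξ i‖)
    · rw [lp.norm_eq_tsum_rpow (by linarith), lp.norm_eq_tsum_rpow (by linarith)]
      congr 1
      exact e.tsum_eq fun i => ‖ξ i‖ ^ p.toReal

end Reindex

section MulOp

variable {X : Type*} [MeasurableSpace X] {ν : Measure X}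

theorem coeFn_mulOp (f : Lp ℂ ∞ ν) (ξ : Lp ℂ 2 ν) : mulOp f ξ =ᵐ[ν] fun x => f x * ξ x :=
  (ContinuousLinearMap.mul ℂ ℂ).coeFn_holder (r := 2) f ξ

theorem mulOp_comm (f g : Lp ℂ ∞ ν) (ξ : Lp ℂ 2 ν) :
    mulOp f (mulOp g ξ) = mulOp g (mulOp f ξ) := by
  apply Lp.ext
  filter_upwards [coeFn_mulOp f (mulOp g ξ), coeFn_mulOp g (mulOp f ξ), coeFn_mulOp f ξ,
    coeFn_mulOp g ξ] with x hfg hgf hf hg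
  rw [hfg, hgf, hf, hg, mul_left_comm]

theorem inner_mulOp_left (f : Lp ℂ ∞ ν) (ξ ζ : Lp ℂ 2 ν) :
    inner ℂ (mulOp f ξ) ζ = inner ℂ ξ (mulOp (star f) ζ) := by
  rw [L2.inner_def, L2.inner_def]
  apply integral_congr_ae
  filter_upwards [coeFn_mulOp f ξ, coeFn_mulOp (star f) ζ, Lp.coeFn_star f] with x hξ hζ hstar
  rw [hξ, hζ, hstar]
  simp only [RCLike.inner_apply, map_mul, Pi.star_apply, RCLike.star_def]
  ring

theorem mulOp_indicatorConstLp_one [IsFiniteMeasure ν] (c : ℂ) {s : Set X}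
    (hs : MeasurableSet s) :
    mulOp (indicatorConstLp ∞ hs (measure_ne_top ν s) c) (Lp.const 2 ν 1) =
      indicatorConstLp 2 hs (measure_ne_top ν s) c := by
  apply Lp.ext
  filter_upwards [coeFn_mulOp (indicatorConstLp ∞ hs (measure_ne_top ν s) c) (Lp.const 2 ν 1),
    indicatorConstLp_coeFn (p := ∞) (hs := hs) (hμs := measure_ne_top ν s) (c := c),
    indicatorConstLp_coeFn (p := 2) (hs := hs) (hμs := measure_ne_top ν s) (c := c),
    Lp.coeFn_const (p := 2) (μ := ν) (1 : ℂ)] with x hmul htop h2 hone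
  rw [hmul, htop, h2, hone, Function.const_apply, mul_one]

theorem ext_of_mulOp_one [IsFiniteMeasure ν] {F : Type*} [AddCommMonoid F] [Module ℂ F]
    [TopologicalSpace F] [T2Space F] {S T : Lp ℂ 2 ν →L[ℂ] F}
    (h : ∀ f : Lp ℂ ∞ ν, S (mulOp f (Lp.const 2 ν 1)) = T (mulOp f (Lp.const 2 ν 1))) :
    S = T := by
  ext1 ξ
  induction ξ using Lp.induction (p := 2) ENNReal.ofNat_ne_top with
  | indicatorConst z hs hμs =>
    rw [Lp.simpleFunc.coe_indicatorConst, ← mulOp_indicatorConstLp_one, h]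
  | add hf hg _ ihf ihg => rw [map_add, map_add, ihf, ihg]
  | isClosed => exact isClosed_eq S.continuous T.continuous

variable {Γ : Type*} [Group Γ] [MulAction Γ X] [NonsingularAction Γ ν]

theorem coeFn_translateLinf (g : Γ) (f : Lp ℂ ∞ ν) :
    translateLinf g f =ᵐ[ν] fun x => f (g⁻¹ • x) :=
  MemLp.coeFn_toLp _

theorem translateLinf_star (g : Γ) (f : Lp ℂ ∞ ν) :
    translateLinf g (star f) = star (translateLinf g f) := by
  have hq := NonsingularAction.quasiMeasurePreserving (ν := ν) g⁻¹
  apply Lp.ext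
  filter_upwards [coeFn_translateLinf g (star f), coeFn_translateLinf g f,
    Lp.coeFn_star (translateLinf g f), hq.ae (Lp.coeFn_star f)] with x hl hf hr hstar
  rw [hl, hr, hstar, Pi.star_apply, Pi.star_apply, hf]

end MulOp

section Commutant

theorem mem_commutant_vonNeumannGenerated {H : Type*} [NormedAddCommGroup H]
    [InnerProductSpace ℂ H] [CompleteSpace H] {S : Set (H →L[ℂ] H)} {T : H →L[ℂ] H}
    (h : ∀ b ∈ S, Commute b T ∧ Commute (star b) T) : T ∈ (vonNeumannGenerated S).commutant := by
  refine VonNeumannAlgebra.mem_commutant_iff.2 fun a ha => ?_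
  exact ((StarSubalgebra.mem_centralizer_iff ℂ).1 ha T
    ((StarSubalgebra.mem_centralizer_iff ℂ).2 h)).1.symm

variable {Γ X : Type*} [MeasurableSpace X] {ν : Measure X}

variable (Γ) in
/-- The diagonal operator `(ξ_h)_h ↦ (f ξ_h)_h` on `ℓ²(Γ, L²(X, ν))`. Unlike `piRep`, it does not
twist `f` by the action, and it lies in the commutant of the crossed product. -/
def diagMulOp (f : Lp ℂ ∞ ν) : HilbertSp Γ ν →L[ℂ] HilbertSp Γ ν :=
  lp.mapCLM 2 (fun _ : Γ => mulOp f) (norm_nonneg f) (fun _ => norm_mulOp_le f)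

theorem diagMulOp_apply (f : Lp ℂ ∞ ν) (ξ : HilbertSp Γ ν) (h : Γ) :
    diagMulOp Γ f ξ h = mulOp f (ξ h) := rfl

variable [Group Γ]

theorem leftRegular_apply (g : Γ) (ξ : HilbertSp Γ ν) (h : Γ) :
    (leftRegular Γ ν g : HilbertSp Γ ν →L[ℂ] HilbertSp Γ ν) ξ h = ξ (g⁻¹ * h) := rfl

theorem star_leftRegular (g : Γ) :
    star (leftRegular Γ ν g : HilbertSp Γ ν →L[ℂ] HilbertSp Γ ν) = leftRegular Γ ν g⁻¹ := by
  rw [map_inv, ← Unitary.coe_star, Unitary.star_eq_inv]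

variable [MulAction Γ X]

/-- The right translation `(R_h ξ)(k) = ξ(k h⁻¹) ∘ h` on `ℓ²(Γ, L²(X, ν))`, for an `h` such that
`h_* ν` is dominated by a finite multiple of `ν`. No Radon-Nikodym factor is inserted, so `R_h` is
not unitary in general, but it maps `δ_e ⊗ 1` to `δ_h ⊗ 1`. -/
def rightOp {h : Γ} {c : ℝ≥0∞} (hh : Measurable fun x : X => h • x) (hc : c ≠ ∞)
    (hle : ν.map (fun x => h • x) ≤ c • ν) : HilbertSp Γ ν →L[ℂ] HilbertSp Γ ν :=
  lp.mapCLM 2 (fun _ : Γ => compOp ℂ ℂ 2 hh hc hle) (norm_nonneg _) (fun _ => le_rfl) ∘L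
    (lpReindex ℂ (Equiv.mulRight h⁻¹)).toContinuousLinearMap

theorem rightOp_apply {h : Γ} {c : ℝ≥0∞} (hh : Measurable fun x : X => h • x) (hc : c ≠ ∞)
    (hle : ν.map (fun x => h • x) ≤ c • ν) (ξ : HilbertSp Γ ν) (k : Γ) :
    rightOp hh hc hle ξ k = compOp ℂ ℂ 2 hh hc hle (ξ (k * h⁻¹)) := rfl

variable [NonsingularAction Γ ν]

theorem piRep_apply (f : Lp ℂ ∞ ν) (ξ : HilbertSp Γ ν) (h : Γ) :
    piRep Γ f ξ h = mulOp (translateLinf h⁻¹ f) (ξ h) := rfl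

theorem star_piRep (f : Lp ℂ ∞ ν) : star (piRep Γ f) = piRep Γ (star f) := by
  rw [ContinuousLinearMap.star_eq_adjoint, eq_comm, ContinuousLinearMap.eq_adjoint_iff]
  intro ξ ζ
  rw [lp.inner_eq_tsum, lp.inner_eq_tsum]
  congr 1 with h
  rw [piRep_apply, piRep_apply, inner_mulOp_left, translateLinf_star, star_star]

theorem mem_commutant_crossedProduct {T : HilbertSp Γ ν →L[ℂ] HilbertSp Γ ν}
    (hπ : ∀ f : Lp ℂ ∞ ν, Commute (piRep Γ f) T)
    (hL : ∀ g : Γ, Commute (leftRegular Γ ν g : HilbertSp Γ ν →L[ℂ] HilbertSp Γ ν) T) :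
    T ∈ (crossedProduct Γ ν).commutant := by
  refine mem_commutant_vonNeumannGenerated ?_
  rintro _ (⟨f, rfl⟩ | ⟨g, rfl⟩)
  · exact ⟨hπ f, by simpa only [star_piRep] using hπ (star f)⟩
  · exact ⟨hL g, by simpa only [star_leftRegular] using hL g⁻¹⟩

theorem diagMulOp_mem_commutant (f : Lp ℂ ∞ ν) :
    diagMulOp Γ f ∈ (crossedProduct Γ ν).commutant := by
  refine mem_commutant_crossedProduct (fun f' => ?_) (fun _ => rfl)
  ext1 ξ
  apply lp.ext
  funext h
  exact mulOp_comm _ _ _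

theorem compOp_mulOp_translateLinf {h : Γ} {c : ℝ≥0∞} (hh : Measurable fun x : X => h • x)
    (hc : c ≠ ∞) (hle : ν.map (fun x => h • x) ≤ c • ν) (k : Γ) (f : Lp ℂ ∞ ν) (ξ : Lp ℂ 2 ν) :
    compOp ℂ ℂ 2 hh hc hle (mulOp (translateLinf k f) ξ) =
      mulOp (translateLinf (h⁻¹ * k) f) (compOp ℂ ℂ 2 hh hc hle ξ) := by
  have hq := NonsingularAction.quasiMeasurePreserving (ν := ν) h
  apply Lp.ext
  filter_upwards [coeFn_compOp ℂ hh hc hle (mulOp (translateLinf k f) ξ),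
    coeFn_compOp ℂ hh hc hle ξ, coeFn_mulOp (translateLinf (h⁻¹ * k) f) (compOp ℂ ℂ 2 hh hc hle ξ),
    coeFn_translateLinf (h⁻¹ * k) f, hq.ae (coeFn_mulOp (translateLinf k f) ξ),
    hq.ae (coeFn_translateLinf k f)] with x hl hξ hr hhk hmul hk
  rw [hl, hr, hξ, hhk, Function.comp_apply, Function.comp_apply, hmul, hk, mul_inv_rev, inv_inv,
    mul_smul]

theorem rightOp_mem_commutant {h : Γ} {c : ℝ≥0∞} (hh : Measurable fun x : X => h • x)
    (hc : c ≠ ∞) (hle : ν.map (fun x => h • x) ≤ c • ν) :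
    rightOp hh hc hle ∈ (crossedProduct Γ ν).commutant := by
  refine mem_commutant_crossedProduct (fun f => ?_) (fun g => ?_) <;>
    refine ContinuousLinearMap.ext fun ξ => lp.ext (funext fun k => ?_)
  · rw [mul_apply_eq_comp, mul_apply_eq_comp, piRep_apply, rightOp_apply, rightOp_apply,
      piRep_apply, compOp_mulOp_translateLinf, mul_inv_rev, inv_inv, inv_mul_cancel_left]
  · rw [mul_apply_eq_comp, mul_apply_eq_comp, leftRegular_apply, rightOp_apply, rightOp_apply,
      leftRegular_apply, mul_assoc]

end Commutant

section Vacuum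

variable {Γ X : Type*} [Group Γ] [MeasurableSpace X] {ν : Measure X} [IsFiniteMeasure ν]

open Classical in
variable (Γ ν) in
/-- The vector `δ_e ⊗ 1` of `ℓ²(Γ, L²(X, ν))`. -/
def vacuum : HilbertSp Γ ν := lp.single 2 1 (Lp.const 2 ν 1)

/-- The component of `a (δ_e ⊗ 1)` at `g`. For `a = ∑ f_g λ_g` in the crossed product this is
`σ_{g⁻¹}(f_g)`, so up to the action it is the `g`-th Fourier coefficient of `a`. -/
def fourierCoeff (a : HilbertSp Γ ν →L[ℂ] HilbertSp Γ ν) (g : Γ) : Lp ℂ 2 ν := a (vacuum Γ ν) g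

open Classical in
theorem leftRegular_vacuum (g : Γ) :
    (leftRegular Γ ν g : HilbertSp Γ ν →L[ℂ] HilbertSp Γ ν) (vacuum Γ ν) =
      lp.single 2 g (Lp.const 2 ν 1) := by
  apply lp.ext
  funext h
  rw [leftRegular_apply, vacuum]
  obtain rfl | hg := eq_or_ne h g
  · rw [inv_mul_cancel, lp.single_apply_self, lp.single_apply_self]
  · rw [lp.single_apply_ne _ _ _ hg, lp.single_apply_ne]
    rwa [Ne, inv_mul_eq_one, eq_comm]

theorem rightOp_vacuum [MulAction Γ X] {h : Γ} {c : ℝ≥0∞} (hh : Measurable fun x : X => h • x)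
    (hc : c ≠ ∞) (hle : ν.map (fun x => h • x) ≤ c • ν) :
    rightOp hh hc hle (vacuum Γ ν) =
      (leftRegular Γ ν h : HilbertSp Γ ν →L[ℂ] HilbertSp Γ ν) (vacuum Γ ν) := by
  classical
  rw [leftRegular_vacuum]
  apply lp.ext
  funext k
  rw [rightOp_apply, vacuum]
  obtain rfl | hk := eq_or_ne k h
  · rw [mul_inv_cancel, lp.single_apply_self, lp.single_apply_self, compOp_const]
  · rw [lp.single_apply_ne _ _ _ hk, lp.single_apply_ne, map_zero]
    rwa [Ne, mul_inv_eq_one]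

open Classical in
theorem diagMulOp_leftRegular_vacuum (f : Lp ℂ ∞ ν) (g : Γ) :
    diagMulOp Γ f ((leftRegular Γ ν g : HilbertSp Γ ν →L[ℂ] HilbertSp Γ ν) (vacuum Γ ν)) =
      lp.single 2 g (mulOp f (Lp.const 2 ν 1)) := by
  rw [leftRegular_vacuum]
  apply lp.ext
  funext h
  rw [diagMulOp_apply]
  obtain rfl | hg := eq_or_ne h g
  · rw [lp.single_apply_self, lp.single_apply_self]
  · rw [lp.single_apply_ne _ _ _ hg, lp.single_apply_ne _ _ _ hg, map_zero]

theorem ext_of_diagMulOp_leftRegular_vacuum {F : Type*} [AddCommMonoid F] [Module ℂ F]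
    [TopologicalSpace F] [T2Space F] {S T : HilbertSp Γ ν →L[ℂ] F}
    (h : ∀ (f : Lp ℂ ∞ ν) (g : Γ),
      S (diagMulOp Γ f ((leftRegular Γ ν g : HilbertSp Γ ν →L[ℂ] HilbertSp Γ ν) (vacuum Γ ν))) =
      T (diagMulOp Γ f ((leftRegular Γ ν g : HilbertSp Γ ν →L[ℂ] HilbertSp Γ ν) (vacuum Γ ν)))) :
    S = T := by
  classical
  refine lp.ext_continuousLinearMap ENNReal.ofNat_ne_top fun g => ext_of_mulOp_one fun f => ?_
  simpa only [diagMulOp_leftRegular_vacuum, ContinuousLinearMap.comp_apply,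
    lp.singleContinuousLinearMap_apply] using h f g

theorem apply_vacuum_eq_smul_of_fourierCoeff {a : HilbertSp Γ ν →L[ℂ] HilbertSp Γ ν} {c : ℂ}
    (hone : fourierCoeff a 1 =ᵐ[ν] fun _ => c) (hne : ∀ g ≠ 1, fourierCoeff a g = 0) :
    a (vacuum Γ ν) = c • vacuum Γ ν := by
  classical
  apply lp.ext
  funext g
  rw [lp.coeFn_smul, Pi.smul_apply, vacuum]
  obtain rfl | hg := eq_or_ne g 1
  · rw [lp.single_apply_self]
    apply Lp.ext
    filter_upwards [hone, Lp.coeFn_smul c (Lp.const 2 ν (1 : ℂ)),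
      Lp.coeFn_const (p := 2) (μ := ν) (1 : ℂ)] with x ha hsmul hconst
    rw [hsmul, Pi.smul_apply, hconst, Function.const_apply, smul_eq_mul, mul_one]
    exact ha
  · rw [lp.single_apply_ne _ _ _ hg, smul_zero]
    exact hne g hg

theorem tsum_enorm_fourierCoeff_sq_ne_top (a : HilbertSp Γ ν →L[ℂ] HilbertSp Γ ν) :
    ∑' g, ‖fourierCoeff a g‖ₑ ^ 2 ≠ ∞ := by
  have h : Summable fun g => ‖fourierCoeff a g‖ ^ 2 := by
    simpa [fourierCoeff] using (lp.memℓp (a (vacuum Γ ν))).summable (by norm_num)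
  simpa [ENNReal.ofReal_pow] using h.tsum_ofReal_ne_top

end Vacuum

section Action

variable {Γ X : Type*} [Group Γ] [MulAction Γ X] [MeasurableSpace X] {ν : Measure X} {μ : PMF Γ}

theorem IsErgodicAction.ae_eq_const {β : Type*} [MeasurableSpace β] [Nonempty β]
    [MeasurableSpace.CountablySeparated β] (herg : IsErgodicAction Γ ν) {f : X → β}
    (hf : Measurable f) (hinv : ∀ g : Γ, (fun x => f (g • x)) =ᵐ[ν] f) :
    ∃ c, f =ᵐ[ν] fun _ => c := by
  refine Filter.exists_eventuallyEq_const_of_forall_separating MeasurableSet fun U hU => ?_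
  have hUinv : ∀ g : Γ, (fun x => g • x) ⁻¹' (f ⁻¹' U) =ᵐ[ν] f ⁻¹' U := fun g => by
    filter_upwards [hinv g] with x hx
    exact congrArg (· ∈ U) hx
  rcases herg (f ⁻¹' U) (hf hU) hUinv with hnull | hconull
  · exact Or.inr (measure_eq_zero_iff_ae_notMem.1 hnull)
  · exact Or.inl hconull

theorem IsStationary.lintegral_eq [NonsingularAction Γ ν] (hstat : IsStationary μ ν)
    {F : X → ℝ≥0∞} (hF : Measurable F) :
    ∫⁻ x, F x ∂ν = ∑' g : Γ, μ g * ∫⁻ x, F (g • x) ∂ν := by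
  conv_lhs => rw [hstat]
  rw [lintegral_sum_measure]
  congr 1 with g
  rw [lintegral_smul_measure, smul_eq_mul,
    lintegral_map hF (NonsingularAction.quasiMeasurePreserving (ν := ν) g).measurable]

theorem IsStationary.map_le_smul (hstat : IsStationary μ ν) {h : Γ} (hh : h ∈ μ.support) :
    ν.map (fun x => h • x) ≤ (μ h)⁻¹ • ν := by
  have hle : μ h • ν.map (fun x => h • x) ≤ ν := by
    conv_rhs => rw [hstat]
    exact Measure.le_sum (fun g : Γ => μ g • ν.map (fun x : X => g • x)) h
  calc ν.map (fun x => h • x) = (μ h)⁻¹ • μ h • ν.map (fun x => h • x) := by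
        rw [smul_smul, ENNReal.inv_mul_cancel hh (μ.apply_ne_top h), one_smul]
    _ ≤ (μ h)⁻¹ • ν := by gcongr

theorem lintegral_enorm_sq_eq (f : Lp ℂ 2 ν) : ∫⁻ x, ‖f x‖ₑ ^ 2 ∂ν = ‖f‖ₑ ^ 2 := by
  have h := eLpNorm_nnreal_pow_eq_lintegral (f := f) (μ := ν) (p := 2) (by norm_num)
  rw [Lp.enorm_def]
  simpa using h.symm

end Action

section RelativeCommutant

variable {Γ X : Type*} [Group Γ] [MulAction Γ X] [MeasurableSpace X] {ν : Measure X} {μ : PMF Γ}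
  [NonsingularAction Γ ν]

theorem conjugationAction_apply_eq_iff_commute {g : Γ} {a : (crossedProduct Γ ν).toStarSubalgebra} :
    conjugationAction Γ ν g a = a ↔
      Commute (a : HilbertSp Γ ν →L[ℂ] HilbertSp Γ ν) (leftRegular Γ ν g) := by
  have h := commute_unitary_iff_star_right_conjugate
    (x := (a : HilbertSp Γ ν →L[ℂ] HilbertSp Γ ν)) (leftRegular Γ ν g).2
  exact Subtype.ext_iff.trans (h.symm.trans Commute.symm_iff)

variable [IsFiniteMeasure ν] {a : HilbertSp Γ ν →L[ℂ] HilbertSp Γ ν}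

theorem eq_smul_one_of_apply_vacuum (ha : a ∈ crossedProduct Γ ν)
    (hL : ∀ g : Γ, Commute a (leftRegular Γ ν g)) {c : ℂ}
    (hc : a (vacuum Γ ν) = c • vacuum Γ ν) : a = c • 1 := by
  refine ext_of_diagMulOp_leftRegular_vacuum fun f g => ?_
  have hD := VonNeumannAlgebra.mem_commutant_iff.1 (diagMulOp_mem_commutant (Γ := Γ) f) a ha
  set L : HilbertSp Γ ν →L[ℂ] HilbertSp Γ ν := ↑(leftRegular Γ ν g)
  calc a (diagMulOp Γ f (L (vacuum Γ ν))) = diagMulOp Γ f (a (L (vacuum Γ ν))) :=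
        DFunLike.congr_fun hD _
    _ = diagMulOp Γ f (L (a (vacuum Γ ν))) :=
        congrArg (diagMulOp Γ f) (DFunLike.congr_fun (hL g).eq _)
    _ = c • diagMulOp Γ f (L (vacuum Γ ν)) := by rw [hc, map_smul, map_smul]

theorem fourierCoeff_comp_smul_of_map_le_smul (ha : a ∈ crossedProduct Γ ν) {h : Γ}
    (hL : Commute a (leftRegular Γ ν h)) {c : ℝ≥0∞} (hc : c ≠ ∞)
    (hle : ν.map (fun x => h • x) ≤ c • ν) (g : Γ) :
    (fun x => fourierCoeff a g (h • x)) =ᵐ[ν] fourierCoeff a (h⁻¹ * g * h) := by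
  have hh := (NonsingularAction.quasiMeasurePreserving (ν := ν) h).measurable
  have hR := VonNeumannAlgebra.mem_commutant_iff.1 (rightOp_mem_commutant hh hc hle) a ha
  set L : HilbertSp Γ ν →L[ℂ] HilbertSp Γ ν := ↑(leftRegular Γ ν h)
  have hRL : rightOp hh hc hle (a (vacuum Γ ν)) = L (a (vacuum Γ ν)) := calc
    rightOp hh hc hle (a (vacuum Γ ν)) = a (rightOp hh hc hle (vacuum Γ ν)) :=
      (DFunLike.congr_fun hR _).symm
    _ = a (L (vacuum Γ ν)) := by rw [rightOp_vacuum]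
    _ = L (a (vacuum Γ ν)) := DFunLike.congr_fun hL.eq _
  have hcoeff : compOp ℂ ℂ 2 hh hc hle (fourierCoeff a g) = fourierCoeff a (h⁻¹ * g * h) := by
    have hgh := congrArg (fun ξ : HilbertSp Γ ν => ξ (g * h)) hRL
    rwa [rightOp_apply, leftRegular_apply, mul_inv_cancel_right, ← mul_assoc] at hgh
  exact hcoeff ▸ (coeFn_compOp ℂ hh hc hle (fourierCoeff a g)).symm

theorem IsStationary.fourierCoeff_comp_smul (hstat : IsStationary μ ν)
    (hμ : Subgroup.closure μ.support = ⊤) (ha : a ∈ crossedProduct Γ ν)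
    (hL : ∀ g : Γ, Commute a (leftRegular Γ ν g)) (h g : Γ) :
    (fun x => fourierCoeff a g (h • x)) =ᵐ[ν] fourierCoeff a (h⁻¹ * g * h) := by
  have hq := NonsingularAction.quasiMeasurePreserving (Γ := Γ) (ν := ν)
  have hh : h ∈ Subgroup.closure μ.support := hμ ▸ Subgroup.mem_top h
  induction hh using Subgroup.closure_induction generalizing g with
  | mem h hh =>
    exact fourierCoeff_comp_smul_of_map_le_smul ha (hL h) (ENNReal.inv_ne_top.2 hh)
      (hstat.map_le_smul hh) g
  | one => simp
  | mul h k _ _ ihh ihk =>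
    filter_upwards [(hq k).ae (ihh g), ihk (h⁻¹ * g * h)] with x hxh hxk
    rw [mul_smul, hxh, hxk]
    simp only [mul_inv_rev, mul_assoc]
  | inv h _ ih =>
    filter_upwards [(hq h⁻¹).ae (ih (h * g * h⁻¹))] with x hx
    simpa [mul_assoc] using hx.symm

theorem IsStationary.enorm_fourierCoeff_sq_harmonic (hstat : IsStationary μ ν)
    (hμ : Subgroup.closure μ.support = ⊤) (ha : a ∈ crossedProduct Γ ν)
    (hL : ∀ g : Γ, Commute a (leftRegular Γ ν g)) (g : Γ) :
    ‖fourierCoeff a g‖ₑ ^ 2 = ∑' h, μ h * ‖fourierCoeff a (h⁻¹ * g * h)‖ₑ ^ 2 := by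
  have hmeas : Measurable fun x => ‖fourierCoeff a g x‖ₑ ^ 2 :=
    (Lp.stronglyMeasurable _).enorm.pow_const 2
  rw [← lintegral_enorm_sq_eq, hstat.lintegral_eq hmeas]
  congr! 2 with h
  rw [← lintegral_enorm_sq_eq]
  congr 1
  refine lintegral_congr_ae ?_
  filter_upwards [hstat.fourierCoeff_comp_smul hμ ha hL h g] with x hx
  rw [hx]

theorem IsStationary.fourierCoeff_eq_zero (hstat : IsStationary μ ν) (hΓ : IsICC Γ)
    (hμ : Subgroup.closure μ.support = ⊤) (ha : a ∈ crossedProduct Γ ν)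
    (hL : ∀ g : Γ, Commute a (leftRegular Γ ν g)) {g : Γ} (hg : g ≠ 1) :
    fourierCoeff a g = 0 := by
  have hsq := hΓ.eq_zero_of_conj_harmonic hμ (tsum_enorm_fourierCoeff_sq_ne_top a)
    (hstat.enorm_fourierCoeff_sq_harmonic hμ ha hL) hg
  exact enorm_eq_zero.1 (eq_zero_of_pow_eq_zero hsq)

theorem IsErgodicAction.fourierCoeff_one_ae_eq_const (herg : IsErgodicAction Γ ν)
    (hstat : IsStationary μ ν) (hμ : Subgroup.closure μ.support = ⊤) (ha : a ∈ crossedProduct Γ ν)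
    (hL : ∀ g : Γ, Commute a (leftRegular Γ ν g)) :
    ∃ c : ℂ, fourierCoeff a 1 =ᵐ[ν] fun _ => c := by
  refine herg.ae_eq_const (Lp.stronglyMeasurable _).measurable fun h => ?_
  simpa using hstat.fourierCoeff_comp_smul hμ ha hL h 1

end RelativeCommutant

end CrossedProductErgodicity

end

theorem lemma3 {Γ X : Type*} [Group Γ] [MulAction Γ X] [MeasurableSpace X]
    (hΓ : CrossedProductErgodicity.IsICC Γ)
    (μ : PMF Γ) (hμ : Subgroup.closure μ.support = ⊤)
    (ν : MeasureTheory.Measure X) [MeasureTheory.IsProbabilityMeasure ν]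
    [CrossedProductErgodicity.NonsingularAction Γ ν]
    (hstat : CrossedProductErgodicity.IsStationary μ ν)
    (herg : CrossedProductErgodicity.IsErgodicAction Γ ν) :
    CrossedProductErgodicity.IsErgodicAutAction
      (CrossedProductErgodicity.conjugationAction Γ ν) := by
  open CrossedProductErgodicity in
  refine Set.Subset.antisymm (fun a ha => ?_)
    (Set.range_subset_iff.2 fun c g => AlgHomClass.commutes (conjugationAction Γ ν g) c)
  have hL : ∀ g : Γ, Commute (a : HilbertSp Γ ν →L[ℂ] HilbertSp Γ ν) (leftRegular Γ ν g) :=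
    fun g => conjugationAction_apply_eq_iff_commute.1 (ha g)
  obtain ⟨c, hone⟩ := herg.fourierCoeff_one_ae_eq_const hstat hμ a.2 hL
  have hvac : (a : HilbertSp Γ ν →L[ℂ] HilbertSp Γ ν) (vacuum Γ ν) = c • vacuum Γ ν :=
    apply_vacuum_eq_smul_of_fourierCoeff hone fun g => hstat.fourierCoeff_eq_zero hΓ hμ a.2 hL
  refine ⟨c, Subtype.ext ?_⟩
  rw [eq_smul_one_of_apply_vacuum a.2 hL hvac, Algebra.algebraMap_eq_smul_one]
  rfl
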